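/- Let $n\ge 2$ and let $(W,S)$ be a finite Coxeter system of type $B_n$, with $S=\{s_1,\dots,s_n\}$ labelled along the Coxeter diagram so that the bond of weight $4$ joins $s_1$ and $s_2$ (so $s_1s_2$ has order $4$, $s_is_{i+1}$ has order $3$ for $2\le i<n$, and all other pairs of generators commute). Let $\ell$ be the length function of $(W,S)$. For $0\le j\le n$ put $$x_j=\sum_{w\in X_j} w\in\mathbb{Q}W,\qquad X_j=\{w\in W:\ \ell(ws_i)>\ell(w)\ \text{for } 1\le i\le j\},$$ and let $\mathfrak{E}(W)=\mathbb{Q}[x_{n-1}]$ be the smallest unital subalgebra of the group algebra $\mathbb{Q}W$ containing $x_{n-1}$. Write $x^{\underline{k}}=\prod_{i=0}^{k-1}(x-i)$ for the falling power, and $\genfrac{[}{]}{0pt}{}{k}{m}$, $\genfrac{\{}{\}}{0pt}{}{k}{m}$ for the (unsigned) Stirling numbers of the first and of the second kind. Then: 1. There is an isomorphism of $\mathbb{Q}$-algebras $\mathfrak{E}(W)\cong\mathbb{Q}[x]/(x^{\underline{n+1}})$ that sends $x_{n-1}$ to the coset of $2x^{\underline{1}}=2x$. 2. $\{x_0,x_1,\dots,x_n\}$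 and $\{x_{n-1}^0,x_{n-1}^1,\dots,x_{n-1}^n\}$ are $\mathbb{Q}$-bases of $\mathfrak{E}(W)$ (each with $n+1$ distinct elements). 3. For $0\le k\le n$, $$x_{n-k}=\prod_{i=0}^{k-1}(x_{n-1}-2i),$$ $$x_{n-k}=\sum_{m=0}^{k}(-2)^{k-m}\genfrac{[}{]}{0pt}{}{k}{m}\,x_{n-1}^m,\qquad x_{n-1}^k=\sum_{m=0}^{k}\genfrac{\{}{\}}{0pt}{}{k}{m}\,2^{k-m}\,x_{n-m}.$$ -/

import Mathlib

open Polynomial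

namespace CoxeterSystem

/-- `X_J = {w ∈ W : ℓ(ws) > ℓ(w) for all s ∈ J}`, where the subset `J` of the simple reflections
is given by its set of indices. -/
def minCosetReps {B W : Type*} [Group W] {M : CoxeterMatrix B} (cs : CoxeterSystem M W)
    (J : Set B) : Set W :=
  {w | ∀ i ∈ J, cs.length w < cs.length (w * cs.simple i)}

open Classical in
/-- The element `x_J = ∑_{w ∈ X_J} w` of the group algebra `ℚW` of a finite Coxeter group; these
elements form the standard basis of the descent algebra. -/
noncomputable def descentElt {B W : Type*} [Group W] [Fintype W] {M : CoxeterMatrix B}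
    (cs : CoxeterSystem M W) (J : Set B) : MonoidAlgebra ℚ W :=
  ∑ w : W with w ∈ cs.minCosetReps J, MonoidAlgebra.of ℚ W w

/-- The set of indices of `{s_1, …, s_j}` in type `B_n`.  The generators are labelled
`s_1, …, s_n` along the diagram with the bond of weight `4` joining `s_1` and `s_2`.  In
`CoxeterMatrix.B n` this bond is at the other end: it joins the indices `n - 1` and `n - 2`.  So
`s_k` is the simple reflection with index `n - k`, and the index `i` belongs to `s_(i.rev + 1)`. -/
def leftIndices (n j : ℕ) : Set (Fin n) :=
  {i | (i.rev : ℕ) + 1 ≤ j}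

/-- The element `x_j = x_J`, `J = {s_1, …, s_j}`, in type `B_n`. -/
noncomputable def xB {n : ℕ} {W : Type*} [Group W] [Fintype W]
    (cs : CoxeterSystem (CoxeterMatrix.B n) W) (j : ℕ) : MonoidAlgebra ℚ W :=
  cs.descentElt (leftIndices n j)

/-- The algebra `𝔈(W) = ℚ[x_{n-1}]`, the smallest unital `ℚ`-subalgebra of `ℚW` that contains
`x_{n-1}`. -/
noncomputable def algEB {n : ℕ} {W : Type*} [Group W] [Fintype W]
    (cs : CoxeterSystem (CoxeterMatrix.B n) W) : Subalgebra ℚ (MonoidAlgebra ℚ W) :=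
  Algebra.adjoin ℚ {cs.xB (n - 1)}

/-- The generator `x_{n-1}` as an element of `𝔈(W)`. -/
noncomputable def genEB {n : ℕ} {W : Type*} [Group W] [Fintype W]
    (cs : CoxeterSystem (CoxeterMatrix.B n) W) : cs.algEB :=
  ⟨cs.xB (n - 1), Algebra.self_mem_adjoin_singleton ℚ (cs.xB (n - 1))⟩

end CoxeterSystem

/-! W acts on ℤ by signed permutations (`signedPerm`). The action is faithful, and right
multiplication by a generator lengthens w exactly when w(i) < w(i+1)
(`length_lt_length_mul_reflB_iff`), where w(0) = 0. So X_j is the set of w with 0 < w(1) < … < w(j),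
and X_{n-1} consists of 2n elements c_t, one for each value p = c_t(n) among ±1, …, ±n.

The heart is the rule x_j x_{n-1} = 2(n-j) x_j + x_{j-1} for j ≥ 1 (`xB_mul`). Right multiplication
by c_t⁻¹ removes the last entry of w(1), …, w(n) and reinserts it, up to sign, at position |p|. If
|p| > j, the first j entries do not change, so x_j c_t = x_j; this happens for 2(n-j) values of t.
Among the other t, each w increasing up to j-1 admits exactly one place and sign for which the
result is increasing up to j, so together they contribute x_{j-1}. For j = 0 this last term is
missing: x_0 x_{n-1} = 2n x_0 (`xB_zero_mul`).

Hence x_{n-k} is the value at x_{n-1} of X(X-2)⋯(X-2(k-1)), and the polynomial of this shape of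
degree n+1 vanishes there. The x_j are linearly independent because their coefficients at the simple
reflections and 1 form a triangular matrix. So 𝔈(W) has dimension n+1. The rest is polynomial
arithmetic: the base changes are Stirling recursions, and halving the variable gives the falling
power. -/

/-! ### Signed swaps of ℤ and their braid relations -/

/-- The action of the simple reflections of type `B` on `ℤ`: the reflection with index `0` changes
the sign of `±1`, and the one with index `i ≥ 1` exchanges `i` and `i + 1`, and `-i` and
`-(i + 1)`. -/
def signedSwap (i : ℕ) (p : ℤ) : ℤ :=
  if i = 0 then (if p = 1 ∨ p = -1 then -p else p)
  else if p = i then p + 1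
  else if p = i + 1 then p - 1
  else if p = -i then p - 1
  else if p = -(i + 1) then p + 1
  else p

theorem signedSwap_involutive (i : ℕ) : Function.Involutive (signedSwap i) := by
  intro p
  unfold signedSwap
  grind

theorem signedSwap_neg (i : ℕ) (p : ℤ) : signedSwap i (-p) = -signedSwap i p := by
  unfold signedSwap
  grind

/-- A disjunction of linear facts is the form in which `omega` can use the action. -/
theorem signedSwap_zero_cases (p : ℤ) :
    p = 1 ∧ signedSwap 0 p = -1 ∨ p = -1 ∧ signedSwap 0 p = 1 ∨
      p ≠ 1 ∧ p ≠ -1 ∧ signedSwap 0 p = p := by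
  unfold signedSwap
  grind

theorem signedSwap_cases {i : ℕ} (hi : 1 ≤ i) (p : ℤ) :
    p = i ∧ signedSwap i p = i + 1 ∨ p = i + 1 ∧ signedSwap i p = i ∨
      p = -i ∧ signedSwap i p = -(i + 1) ∨ p = -(i + 1) ∧ signedSwap i p = -i ∨
      p ≠ i ∧ p ≠ i + 1 ∧ p ≠ -i ∧ p ≠ -(i + 1) ∧ signedSwap i p = p := by
  unfold signedSwap
  split_ifs <;> omega

theorem signedSwap_comm {i j : ℕ} (h : i + 2 ≤ j) (p : ℤ) :
    signedSwap i (signedSwap j p) = signedSwap j (signedSwap i p) := by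
  have hj := fun p ↦ signedSwap_cases (show 1 ≤ j by omega) p
  rcases Nat.eq_zero_or_pos i with rfl | h0
  · have h1 := hj p
    have h2 := signedSwap_zero_cases p
    have h3 := hj (signedSwap 0 p)
    have h4 := signedSwap_zero_cases (signedSwap j p)
    omega
  · have h1 := hj p
    have h2 := signedSwap_cases h0 p
    have h3 := hj (signedSwap i p)
    have h4 := signedSwap_cases h0 (signedSwap j p)
    omega

theorem signedSwap_braid_three {i : ℕ} (h : 1 ≤ i) (p : ℤ) :
    signedSwap i (signedSwap (i + 1) (signedSwap i p)) =
      signedSwap (i + 1) (signedSwap i (signedSwap (i + 1) p)) := by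
  have hi := fun p ↦ signedSwap_cases h p
  have hj := fun p ↦ signedSwap_cases (show 1 ≤ i + 1 by omega) p
  push_cast at hj
  have h1 := hi p
  have h2 := hj (signedSwap i p)
  have h3 := hi (signedSwap (i + 1) (signedSwap i p))
  have h1' := hj p
  have h2' := hi (signedSwap (i + 1) p)
  have h3' := hj (signedSwap i (signedSwap (i + 1) p))
  omega

theorem signedSwap_braid_four (p : ℤ) :
    signedSwap 0 (signedSwap 1 (signedSwap 0 (signedSwap 1 p))) =
      signedSwap 1 (signedSwap 0 (signedSwap 1 (signedSwap 0 p))) := by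
  have hj := fun p ↦ signedSwap_cases le_rfl p
  push_cast at hj
  by_cases hp : p = 1 ∨ p = -1 ∨ p = 2 ∨ p = -2
  · rcases hp with rfl | rfl | rfl | rfl <;> rfl
  · have h0 : signedSwap 0 p = p := by have := signedSwap_zero_cases p; omega
    have h1 : signedSwap 1 p = p := by have := hj p; omega
    simp [h0, h1]

/-- `signedSwap` as a permutation of `ℤ`. -/
def signedSwapPerm (i : ℕ) : Equiv.Perm ℤ := (signedSwap_involutive i).toPerm

@[simp]
theorem signedSwapPerm_apply (i : ℕ) (p : ℤ) : signedSwapPerm i p = signedSwap i p := rfl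

/-! ### The Coxeter relations of type B -/

namespace CoxeterMatrix

theorem B_apply (n : ℕ) (i j : Fin n) : CoxeterMatrix.B n i j =
    if i = j then 1
      else if (i : ℕ) = n - 1 ∧ (j : ℕ) = n - 2 ∨ (j : ℕ) = n - 1 ∧ (i : ℕ) = n - 2 then 4
        else if (j : ℕ) + 1 = i ∨ (i : ℕ) + 1 = j then 3 else 2 := rfl

theorem B_rev_comm {n i j : ℕ} (hi : i < n) (hj : j < n) (h : i + 2 ≤ j) :
    CoxeterMatrix.B n (Fin.rev ⟨i, hi⟩) (Fin.rev ⟨j, hj⟩) = 2 := by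
  rw [B_apply, if_neg (by simp [Fin.ext_iff]; omega), if_neg (by simp; omega),
    if_neg (by simp; omega)]

theorem B_rev_three {n i : ℕ} (h : i + 1 < n) (hi : 1 ≤ i) :
    CoxeterMatrix.B n (Fin.rev ⟨i, by omega⟩) (Fin.rev ⟨i + 1, h⟩) = 3 := by
  rw [B_apply, if_neg (by simp [Fin.ext_iff]; omega), if_neg (by simp; omega),
    if_pos (by simp; omega)]

theorem B_rev_four {n : ℕ} (h : 1 < n) :
    CoxeterMatrix.B n (Fin.rev ⟨0, by omega⟩) (Fin.rev ⟨1, h⟩) = 4 := by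
  rw [B_apply, if_neg (by simp [Fin.ext_iff]; omega), if_pos (by simp)]

end CoxeterMatrix

theorem mul_pow_swap_eq_one {G : Type*} [Group G] {a b : G} {m : ℕ} (h : (a * b) ^ m = 1) :
    (b * a) ^ m = 1 := by
  have : b * a = a⁻¹ * (a * b) * a⁻¹⁻¹ := by group
  rw [this, conj_pow, h]; simp

theorem signedSwapPerm_isLiftable (n : ℕ) :
    (CoxeterMatrix.B n).IsLiftable fun i ↦ signedSwapPerm i.rev := by
  have key : ∀ i j : ℕ, ∀ (hi : i < n) (hj : j < n), i ≤ j →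
      (signedSwapPerm i * signedSwapPerm j) ^
        CoxeterMatrix.B n (Fin.rev ⟨i, hi⟩) (Fin.rev ⟨j, hj⟩) = 1 := by
    intro i j hi hj hij
    have inv (i : ℕ) (p : ℤ) := signedSwap_involutive i p
    rcases hij.eq_or_lt with rfl | hij
    · ext p
      simp [inv]
    rcases Nat.lt_or_ge (i + 1) j with hij' | hij'
    · rw [CoxeterMatrix.B_rev_comm hi hj hij']
      ext p
      simp [pow_succ, ← signedSwap_comm hij', inv]
    obtain rfl : j = i + 1 := by omega
    rcases Nat.eq_zero_or_pos i with rfl | h0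
    · rw [CoxeterMatrix.B_rev_four hj]
      ext p
      simp [pow_succ, signedSwap_braid_four, inv]
    · rw [CoxeterMatrix.B_rev_three hj h0]
      ext p
      simp [pow_succ, ← signedSwap_braid_three h0, inv]
  intro i j
  -- The Coxeter matrix numbers the diagram from the other end, so `key` is applied to reversed
  -- indices, in whichever order is increasing.
  have hi := key i.rev j.rev i.rev.2 j.rev.2
  have hj := key j.rev i.rev j.rev.2 i.rev.2
  simp only [Fin.eta, Fin.rev_rev] at hi hj
  rcases le_total (i.rev : ℕ) j.rev with h | h
  · exact hi h
  · rw [CoxeterMatrix.symmetric]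
    exact mul_pow_swap_eq_one (hj h)

/-! ### The signed permutation representation -/

namespace CoxeterSystem

variable {n : ℕ} {W : Type*} [Group W] (cs : CoxeterSystem (CoxeterMatrix.B n) W)

/-- The simple reflections of type `B_n`, numbered from `0` along the diagram, with the bond of
weight `4` between `0` and `1`. For `i ≥ n` the value is `1`. -/
def reflB (i : ℕ) : W := if h : i < n then cs.simple (Fin.rev ⟨i, h⟩) else 1

/-- The action of a Coxeter group of type `B_n` on `ℤ` by signed permutations. -/
def signedPerm : W →* Equiv.Perm ℤ := cs.lift ⟨_, signedSwapPerm_isLiftable n⟩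

theorem reflB_rev (i : Fin n) : cs.reflB i.rev = cs.simple i := by
  simp only [reflB, Fin.is_lt, dif_pos, Fin.eta, Fin.rev_rev]

theorem reflB_of_lt {i : ℕ} (h : i < n) : cs.reflB i = cs.simple (Fin.rev ⟨i, h⟩) := dif_pos h

theorem reflB_mul_self (i : ℕ) : cs.reflB i * cs.reflB i = 1 := by
  unfold reflB; split <;> simp

theorem signedPerm_reflB {i : ℕ} (h : i < n) (p : ℤ) :
    cs.signedPerm (cs.reflB i) p = signedSwap i p := by
  rw [cs.reflB_of_lt h, signedPerm, lift_apply_simple]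
  simp

theorem mul_comm_of_mul_pow_two_eq_one {a b : W} (ha : a * a = 1) (hb : b * b = 1) (h : (a * b) ^ 2 = 1) :
    a * b = b * a := by
  have ha' := inv_eq_of_mul_eq_one_left ha
  have hb' := inv_eq_of_mul_eq_one_left hb
  calc a * b = (a * b)⁻¹ := by rw [eq_inv_iff_mul_eq_one, ← pow_two, h]
    _ = b * a := by rw [mul_inv_rev, ha', hb']

theorem reflB_comm {i j : ℕ} (h : i + 2 ≤ j) :
    cs.reflB i * cs.reflB j = cs.reflB j * cs.reflB i := by
  by_cases hj : j < n
  · refine mul_comm_of_mul_pow_two_eq_one (cs.reflB_mul_self i) (cs.reflB_mul_self j) ?_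
    rw [cs.reflB_of_lt hj, cs.reflB_of_lt (by omega), ← CoxeterMatrix.B_rev_comm (by omega) hj h]
    exact cs.simple_mul_simple_pow _ _
  · simp [reflB, hj]

theorem reflB_braid_three {i : ℕ} (hi : 1 ≤ i) (h : i + 1 < n) :
    cs.reflB i * cs.reflB (i + 1) * cs.reflB i =
      cs.reflB (i + 1) * cs.reflB i * cs.reflB (i + 1) := by
  have ha := inv_eq_of_mul_eq_one_left (cs.reflB_mul_self i)
  have hb := inv_eq_of_mul_eq_one_left (cs.reflB_mul_self (i + 1))
  have h3 : (cs.reflB i * cs.reflB (i + 1)) ^ 3 = 1 := by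
    rw [cs.reflB_of_lt h, cs.reflB_of_lt (by omega), ← CoxeterMatrix.B_rev_three h hi]
    exact cs.simple_mul_simple_pow _ _
  calc _ = (cs.reflB (i + 1) * cs.reflB i * cs.reflB (i + 1))⁻¹ := by
        rw [eq_inv_iff_mul_eq_one, ← h3]; simp [pow_succ, mul_assoc]
    _ = _ := by simp [mul_assoc, ha, hb]

theorem reflB_braid_four (h : 1 < n) :
    cs.reflB 0 * cs.reflB 1 * cs.reflB 0 * cs.reflB 1 =
      cs.reflB 1 * cs.reflB 0 * cs.reflB 1 * cs.reflB 0 := by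
  have ha := inv_eq_of_mul_eq_one_left (cs.reflB_mul_self 0)
  have hb := inv_eq_of_mul_eq_one_left (cs.reflB_mul_self 1)
  have h4 : (cs.reflB 0 * cs.reflB 1) ^ 4 = 1 := by
    rw [cs.reflB_of_lt h, cs.reflB_of_lt (by omega), ← CoxeterMatrix.B_rev_four h]
    exact cs.simple_mul_simple_pow _ _
  calc _ = (cs.reflB 0 * cs.reflB 1 * cs.reflB 0 * cs.reflB 1)⁻¹ := by
        rw [eq_inv_iff_mul_eq_one, ← h4]; simp [pow_succ, mul_assoc]
    _ = _ := by simp [mul_assoc, ha, hb]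

theorem reflB_induction_left {P : W → Prop} (w : W) (one : P 1)
    (mul : ∀ i < n, ∀ w, P w → P (cs.reflB i * w)) : P w := by
  refine cs.simple_induction_left w one fun w i hw ↦ ?_
  rw [← cs.reflB_rev i]
  exact mul _ i.rev.2 _ hw

theorem signedPerm_neg (w : W) (p : ℤ) : cs.signedPerm w (-p) = -cs.signedPerm w p := by
  induction w using cs.reflB_induction_left with
  | one => simp
  | mul i hi w hw => simp [hw, cs.signedPerm_reflB hi, signedSwap_neg]

theorem signedPerm_zero (w : W) : cs.signedPerm w 0 = 0 := by
  have := cs.signedPerm_neg w 0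
  simp only [neg_zero] at this
  omega

theorem abs_signedPerm_le (w : W) {p : ℤ} (hp : |p| ≤ n) : |cs.signedPerm w p| ≤ n := by
  induction w using cs.reflB_induction_left with
  | one => simpa
  | mul i hi w hw =>
    rw [map_mul, Equiv.Perm.mul_apply, cs.signedPerm_reflB hi]
    rw [abs_le] at hw ⊢
    unfold signedSwap
    split_ifs <;> omega

/-! ### Coset representatives and faithfulness -/

/-- The parabolic subgroup generated by the first `k` simple reflections. -/
def parabolicB (k : ℕ) : Subgroup W := Subgroup.closure (cs.reflB '' {i | i < k})

/-- The index of the `t`-th factor in the coset representatives `cosetRepB`: the sequence is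
`k - 1, …, 1, 0, 1, …, k - 1`. -/
def cosetLabel (k t : ℕ) : ℕ := ((k : ℤ) - 1 - t).natAbs

/-- For `t < 2 k`, representatives of the left cosets of `parabolicB (k - 1)` in `parabolicB k`. -/
def cosetRepB (k : ℕ) : ℕ → W
  | 0 => 1
  | t + 1 => cs.reflB (cosetLabel k t) * cosetRepB k t

theorem cosetRepB_zero (k : ℕ) : cs.cosetRepB k 0 = 1 := rfl

theorem cosetRepB_succ (k t : ℕ) :
    cs.cosetRepB k (t + 1) = cs.reflB (cosetLabel k t) * cs.cosetRepB k t := rfl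

theorem reflB_mem_parabolicB {i k : ℕ} (h : i < k) : cs.reflB i ∈ cs.parabolicB k :=
  Subgroup.subset_closure ⟨i, h, rfl⟩

theorem parabolicB_zero : cs.parabolicB 0 = ⊥ := by simp [parabolicB]

theorem parabolicB_self : cs.parabolicB n = ⊤ := by
  rw [Subgroup.eq_top_iff']
  intro w
  induction w using cs.reflB_induction_left with
  | one => exact one_mem _
  | mul i hi w hw => exact mul_mem (cs.reflB_mem_parabolicB hi) hw

/-- The hypotheses exclude the generators that extend the word of `cosetRepB k t` or cancel its
first letter. Any other generator moves to the right through the word: it commutes with letters not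
adjacent to it in the diagram, and at an adjacent letter a braid relation applies, of length four
around the letter 0. What comes out on the right is a generator of `parabolicB (k - 1)`. -/
theorem reflB_mul_cosetRepB_of_ne {k : ℕ} (hk : k ≤ n) (t : ℕ) : ∀ i < k, t < 2 * k →
    i ≠ cosetLabel k t → (∀ t', t = t' + 1 → i ≠ cosetLabel k t') →
    ∃ h ∈ cs.parabolicB (k - 1), cs.reflB i * cs.cosetRepB k t = cs.cosetRepB k t * h := by
  induction t using Nat.strong_induction_on with
  | h t ih =>
    intro i hi ht h1 h2
    rcases t with _ | t
    · refine ⟨cs.reflB i, cs.reflB_mem_parabolicB ?_, by simp [cosetRepB_zero]⟩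
      unfold cosetLabel at h1
      omega
    have h3 := h2 t rfl
    have hcomm : ∀ {a : ℕ}, (i + 2 ≤ a ∨ a + 2 ≤ i) →
        cs.reflB i * cs.reflB a = cs.reflB a * cs.reflB i := by
      rintro a (h | h)
      · exact cs.reflB_comm h
      · exact (cs.reflB_comm h).symm
    by_cases hadj : i + 2 ≤ cosetLabel k t ∨ cosetLabel k t + 2 ≤ i
    · obtain ⟨h, hh, e⟩ := ih t (by omega) i hi (by omega) h3 (by
        rintro s rfl
        unfold cosetLabel at *
        omega)
      refine ⟨h, hh, ?_⟩
      rw [cosetRepB_succ, ← mul_assoc, hcomm hadj, mul_assoc, e, mul_assoc]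
    rcases t with _ | s
    · unfold cosetLabel at *
      omega
    have his : i = cosetLabel k s := by
      unfold cosetLabel at *
      omega
    rcases Nat.eq_zero_or_pos i with h0 | h0
    · have ha : cosetLabel k (s + 1) = 1 := by omega
      have hs : s + 1 = k := by unfold cosetLabel at *; omega
      rcases s with _ | s
      · omega
      have hb : cosetLabel k s = 1 := by unfold cosetLabel at *; omega
      obtain ⟨h, hh, e⟩ := ih s (by omega) 0 (by omega) (by omega) (by omega) (by
        rintro r rfl
        unfold cosetLabel at *
        omega)
      refine ⟨h, hh, ?_⟩
      have hbr := cs.reflB_braid_four (by omega)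
      rw [cosetRepB_succ, cosetRepB_succ, cosetRepB_succ, ha, ← his, hb, h0]
      simp only [← mul_assoc] at hbr ⊢
      rw [hbr, mul_assoc, e]
      simp only [mul_assoc]
    · have ha : 1 ≤ cosetLabel k (s + 1) := by unfold cosetLabel at *; omega
      obtain ⟨h, hh, e⟩ := ih s (by omega) (cosetLabel k (s + 1))
        (by unfold cosetLabel at *; omega) (by omega) (by omega) (by
        rintro r rfl
        unfold cosetLabel at *
        omega)
      refine ⟨h, hh, ?_⟩
      rw [cosetRepB_succ, cosetRepB_succ, ← his]
      have hbr : cs.reflB i * cs.reflB (cosetLabel k (s + 1)) * cs.reflB i =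
          cs.reflB (cosetLabel k (s + 1)) * cs.reflB i * cs.reflB (cosetLabel k (s + 1)) := by
        rcases (by omega : cosetLabel k (s + 1) = i + 1 ∨ i = cosetLabel k (s + 1) + 1)
          with h | h
        · rw [h]
          exact cs.reflB_braid_three h0 (by unfold cosetLabel at *; omega)
        · have hb := cs.reflB_braid_three ha (by omega)
          rw [← h] at hb
          exact hb.symm
      simp only [← mul_assoc]
      rw [hbr, mul_assoc, e]
      simp only [mul_assoc]

theorem reflB_mul_cosetRepB {k : ℕ} (hk : k ≤ n) {t i : ℕ} (ht : t < 2 * k) (hi : i < k) :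
    ∃ t' < 2 * k, ∃ h ∈ cs.parabolicB (k - 1),
      cs.reflB i * cs.cosetRepB k t = cs.cosetRepB k t' * h := by
  by_cases h1 : i = cosetLabel k t
  · refine ⟨t + 1, ?_, 1, one_mem _, by rw [cosetRepB_succ, h1, mul_one]⟩
    unfold cosetLabel at h1
    omega
  by_cases h2 : ∀ t', t = t' + 1 → i ≠ cosetLabel k t'
  · exact ⟨t, ht, cs.reflB_mul_cosetRepB_of_ne hk t i hi ht h1 h2⟩
  · push Not at h2
    obtain ⟨s, rfl, rfl⟩ := h2
    refine ⟨s, by omega, 1, one_mem _, ?_⟩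
    rw [cosetRepB_succ, ← mul_assoc, reflB_mul_self, one_mul, mul_one]

theorem exists_eq_cosetRepB_mul {k : ℕ} (hk : k ≤ n) (h0 : 1 ≤ k) {w : W}
    (hw : w ∈ cs.parabolicB k) :
    ∃ t < 2 * k, ∃ h ∈ cs.parabolicB (k - 1), w = cs.cosetRepB k t * h := by
  have step : ∀ i < k, ∀ w, (∃ t < 2 * k, ∃ h ∈ cs.parabolicB (k - 1),
      w = cs.cosetRepB k t * h) → ∃ t < 2 * k, ∃ h ∈ cs.parabolicB (k - 1),
      cs.reflB i * w = cs.cosetRepB k t * h := by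
    rintro i hi w ⟨t, ht, h, hh, rfl⟩
    obtain ⟨t', ht', h', hh', e⟩ := cs.reflB_mul_cosetRepB hk ht hi
    exact ⟨t', ht', h' * h, mul_mem hh' hh, by rw [← mul_assoc, e, mul_assoc]⟩
  unfold parabolicB at hw
  induction hw using Subgroup.closure_induction_left with
  | one => exact ⟨0, by omega, 1, one_mem _, by simp [cosetRepB_zero]⟩
  | mul_left x hx y _ ih =>
    obtain ⟨i, hi, rfl⟩ := hx
    exact step i hi y ih
  | inv_mul_cancel x hx y _ ih =>
    obtain ⟨i, hi, rfl⟩ := hx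
    rw [inv_eq_of_mul_eq_one_left (cs.reflB_mul_self i)]
    exact step i hi y ih

/-- The image of `k` under `cosetRepB k t`. -/
def cosetPoint (k t : ℕ) : ℤ := if t < k then (k : ℤ) - t else (k : ℤ) - 1 - t

/-- Each new factor moves the image of k one step down the list k, …, 1, -1, …, -k; its label is
that of the swap doing so. -/
theorem signedPerm_cosetRepB {k : ℕ} (hk : k ≤ n) (h0 : 1 ≤ k) {t : ℕ} (ht : t < 2 * k) :
    cs.signedPerm (cs.cosetRepB k t) k = cosetPoint k t ∧
    ∀ i : ℤ, 1 ≤ i → i < k →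
      cs.signedPerm (cs.cosetRepB k t) i = if i < |cosetPoint k t| then i else i + 1 := by
  induction t with
  | zero =>
    have h : cosetPoint k 0 = k := by simp [cosetPoint]; omega
    refine ⟨by simp [cosetRepB_zero, h], fun i _ hik ↦ ?_⟩
    rw [h, Nat.abs_cast, if_pos hik, cosetRepB_zero, map_one, Equiv.Perm.one_apply]
  | succ t ih =>
    obtain ⟨h1, h2⟩ := ih (by omega)
    have hl : cosetLabel k t < n := by unfold cosetLabel; omega
    have hp : t < k ∧ cosetPoint k t = k - t ∨ k ≤ t ∧ cosetPoint k t = k - 1 - t := by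
      unfold cosetPoint; split_ifs <;> omega
    have hp' : t + 1 < k ∧ cosetPoint k (t + 1) = k - t - 1 ∨
        k ≤ t + 1 ∧ cosetPoint k (t + 1) = k - 2 - t := by
      unfold cosetPoint; split_ifs <;> push_cast <;> omega
    have hc : cosetLabel k t = 0 ∧ t + 1 = k ∨ 1 ≤ cosetLabel k t ∧
        (t + 1 < k ∧ (cosetLabel k t : ℤ) = k - 1 - t ∨
          k ≤ t ∧ (cosetLabel k t : ℤ) = t + 1 - k) := by
      unfold cosetLabel; omega
    rw [cosetRepB_succ, map_mul]
    simp only [Equiv.Perm.mul_apply, cs.signedPerm_reflB hl]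
    constructor
    · rw [h1]
      rcases hc with ⟨h, hc⟩ | ⟨h, hc⟩
      · have := signedSwap_zero_cases (cosetPoint k t)
        rw [h]
        omega
      · have := signedSwap_cases h (cosetPoint k t)
        omega
    · intro i hi hik
      rw [h2 i hi hik]
      split_ifs with ha hb hb
      all_goals
        rw [lt_abs] at ha hb
        rcases hc with ⟨h, hc⟩ | ⟨h, hc⟩
        · have := signedSwap_zero_cases i
          have := signedSwap_zero_cases (i + 1)
          rw [h]
          omega
        · have := signedSwap_cases h i
          have := signedSwap_cases h (i + 1)
          omega

theorem signedPerm_of_mem_parabolicB {k : ℕ} (hk : k ≤ n) {w : W} (hw : w ∈ cs.parabolicB k)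
    {p : ℤ} (hp : k < p) : cs.signedPerm w p = p := by
  unfold parabolicB at hw
  induction hw using Subgroup.closure_induction with
  | mem x hx =>
    obtain ⟨i, hi, rfl⟩ := hx
    simp only [Set.mem_ofPred_eq] at hi
    rw [cs.signedPerm_reflB (by omega)]
    unfold signedSwap
    split_ifs <;> omega
  | one => simp
  | mul x y _ _ hx hy => rw [map_mul, Equiv.Perm.mul_apply, hy, hx]
  | inv x _ hx =>
    rw [map_inv, Equiv.Perm.inv_eq_iff_eq, hx]

/-- Induction along the chain of parabolic subgroups: the image of k+1 determines the coset, and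
only the trivial coset fixes k+1. -/
theorem signedPerm_injective : Function.Injective cs.signedPerm := by
  rw [injective_iff_map_eq_one]
  have key : ∀ k ≤ n, ∀ w ∈ cs.parabolicB k, cs.signedPerm w = 1 → w = 1 := by
    intro k
    induction k with
    | zero =>
      intro _ w hw _
      rwa [parabolicB_zero, Subgroup.mem_bot] at hw
    | succ k ih =>
      intro hk w hw h
      obtain ⟨t, ht, x, hx, rfl⟩ := cs.exists_eq_cosetRepB_mul hk (by omega) hw
      rw [Nat.add_sub_cancel] at hx
      have h1 : cs.signedPerm (cs.cosetRepB (k + 1) t * x) (k + 1 : ℕ) = (k + 1 : ℕ) := by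
        rw [h]; rfl
      rw [map_mul, Equiv.Perm.mul_apply,
        cs.signedPerm_of_mem_parabolicB (by omega) hx (by push_cast; omega),
        (cs.signedPerm_cosetRepB hk (by omega) ht).1] at h1
      obtain rfl : t = 0 := by
        unfold cosetPoint at h1
        split_ifs at h1 <;> push_cast at h1 <;> omega
      rw [cosetRepB_zero, one_mul] at h ⊢
      exact ih (by omega) x hx h
  intro w hw
  exact key n le_rfl w (by simp [parabolicB_self]) hw

/-! ### Length and descents -/

/-- The reflection s_j reverses the order of w(i) and w(i+1) only if it exchanges these two values,
or, for i = j = 0, if w(1) = 1. Then both sides act by the same signed permutation, and faithfulness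
applies. -/
theorem reflB_mul_eq_mul_reflB {w : W} {i j : ℕ} (hi : i < n) (hj : j < n)
    (h : cs.signedPerm w i < cs.signedPerm w (i + 1))
    (h' : cs.signedPerm (cs.reflB j * w) (i + 1) ≤ cs.signedPerm (cs.reflB j * w) i) :
    cs.reflB j * w = w * cs.reflB i := by
  set f := cs.signedPerm w with hf
  have finj : ∀ a b, f a = f b → a = b := fun a b e ↦ f.injective e
  have fneg : ∀ p, f (-p) = -f p := cs.signedPerm_neg w
  have f0 : f 0 = 0 := cs.signedPerm_zero w
  simp only [map_mul, Equiv.Perm.mul_apply, cs.signedPerm_reflB hj, ← hf] at h'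
  have key : i = 0 ∧ j = 0 ∧ f 1 = 1 ∨ 1 ≤ i ∧ 1 ≤ j ∧
      (f i = j ∧ f (i + 1) = j + 1 ∨ f i = -(j + 1) ∧ f (i + 1) = -j) := by
    rcases Nat.eq_zero_or_pos i with rfl | hi0
    · simp only [Nat.cast_zero, f0, zero_add] at h h'
      rcases Nat.eq_zero_or_pos j with rfl | hj0
      · have h1 := signedSwap_zero_cases 0
        have h2 := signedSwap_zero_cases (f 1)
        omega
      · have h1 := signedSwap_cases hj0 0
        have h2 := signedSwap_cases hj0 (f 1)
        omega
    · have e1 := finj i 0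
      have e2 := finj (i + 1) 0
      have e3 := finj (i + 1) (-i)
      rw [fneg] at e3
      rcases Nat.eq_zero_or_pos j with rfl | hj0
      · have h1 := signedSwap_zero_cases (f i)
        have h2 := signedSwap_zero_cases (f (i + 1))
        omega
      · have h1 := signedSwap_cases hj0 (f i)
        have h2 := signedSwap_cases hj0 (f (i + 1))
        omega
  apply cs.signedPerm_injective
  ext p
  simp only [map_mul, Equiv.Perm.mul_apply, cs.signedPerm_reflB hj, cs.signedPerm_reflB hi, ← hf]
  rcases key with ⟨rfl, rfl, h1⟩ | ⟨hi0, hj0, h1⟩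
  · have e1 := finj p 1
    have e2 := finj p (-1)
    have e3 := fneg 1
    have e4 := signedSwap_zero_cases (f p)
    rcases signedSwap_zero_cases p with ⟨rfl, e⟩ | ⟨rfl, e⟩ | ⟨_, _, e⟩ <;> rw [e] <;> omega
  · have e1 := finj p i
    have e2 := finj p (i + 1)
    have e3 := finj p (-i)
    have e4 := finj p (-(i + 1))
    have e5 := fneg i
    have e6 := fneg (i + 1)
    have e7 := signedSwap_cases hj0 (f p)
    rcases signedSwap_cases hi0 p with ⟨rfl, e⟩ | ⟨rfl, e⟩ | ⟨rfl, e⟩ | ⟨rfl, e⟩ | ⟨_, _, _, _, e⟩ <;>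
      rw [e] <;> omega

/-- The exchange condition. Building the word from its right end starts from the identity, where i
precedes i+1; the letter that reverses the two images can be deleted. -/
theorem exists_wordProd_mul_reflB {i : ℕ} (hi : i < n) (ω : List (Fin n))
    (h : cs.signedPerm (cs.wordProd ω) (i + 1) ≤ cs.signedPerm (cs.wordProd ω) i) :
    ∃ τ : List (Fin n), τ.length + 1 = ω.length ∧
      cs.wordProd τ = cs.wordProd ω * cs.reflB i := by
  induction ω with
  | nil => simp at h
  | cons k ω ih =>
    by_cases h1 : cs.signedPerm (cs.wordProd ω) i < cs.signedPerm (cs.wordProd ω) (i + 1)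
    · refine ⟨ω, rfl, ?_⟩
      rw [wordProd_cons, ← cs.reflB_rev] at h ⊢
      rw [cs.reflB_mul_eq_mul_reflB hi k.rev.2 h1 h, mul_assoc, reflB_mul_self, mul_one]
    · obtain ⟨τ, hτ, e⟩ := ih (not_lt.mp h1)
      exact ⟨k :: τ, by simp [hτ], by rw [wordProd_cons, wordProd_cons, e, mul_assoc]⟩

theorem length_mul_reflB_lt {i : ℕ} (hi : i < n) {w : W}
    (h : cs.signedPerm w (i + 1) ≤ cs.signedPerm w i) :
    cs.length (w * cs.reflB i) < cs.length w := by
  obtain ⟨ω, hω, rfl⟩ := cs.exists_isReduced w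
  obtain ⟨τ, hτ, e⟩ := cs.exists_wordProd_mul_reflB hi ω h
  rw [← e, hω.eq, ← hτ]
  exact Nat.lt_succ_of_le (cs.length_wordProd_le τ)

theorem length_lt_length_mul_reflB_iff {i : ℕ} (hi : i < n) {w : W} :
    cs.length w < cs.length (w * cs.reflB i) ↔
      cs.signedPerm w i < cs.signedPerm w (i + 1) := by
  refine ⟨fun h ↦ lt_of_not_ge fun h' ↦ ?_, fun h ↦ ?_⟩
  · exact h.not_gt (cs.length_mul_reflB_lt hi h')
  -- Multiplying by the reflection reverses the ascent, so the other direction applies to the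
  -- product.
  · have key : cs.signedPerm (w * cs.reflB i) (i + 1) ≤ cs.signedPerm (w * cs.reflB i) i := by
      simp only [map_mul, Equiv.Perm.mul_apply, cs.signedPerm_reflB hi]
      rcases Nat.eq_zero_or_pos i with rfl | h0
      · have e1 : signedSwap 0 ((0 : ℕ) + 1) = -1 := rfl
        have e2 : signedSwap 0 (0 : ℕ) = 0 := rfl
        have := cs.signedPerm_neg w 1
        have := cs.signedPerm_zero w
        simp only [e1, e2]
        simp at h
        omega
      · have e1 : signedSwap i (i + 1) = i := by have := signedSwap_cases h0 (i + 1); omega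
        have e2 : signedSwap i i = i + 1 := by have := signedSwap_cases h0 i; omega
        rw [e1, e2]
        exact h.le
    have := cs.length_mul_reflB_lt hi key
    rwa [mul_assoc, reflB_mul_self, mul_one] at this

/-! ### Increasing signed permutations and insertion of an entry -/

/-- The signed permutation of `w` is increasing on `0, 1, …, j`. -/
def IncreasingUpTo (w : W) (j : ℕ) : Prop :=
  ∀ i : ℕ, i < j → cs.signedPerm w i < cs.signedPerm w (i + 1)

variable {cs} in
theorem IncreasingUpTo.lt {w : W} {j : ℕ} (h : cs.IncreasingUpTo w j) {a b : ℤ} (ha : 0 ≤ a)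
    (hab : a < b) (hb : b ≤ j) : cs.signedPerm w a < cs.signedPerm w b := by
  lift a to ℕ using ha
  obtain ⟨d, rfl⟩ : ∃ d : ℕ, b = a + d + 1 := ⟨(b - a - 1).toNat, by omega⟩
  induction d with
  | zero => simpa using h a (by omega)
  | succ d ih =>
    refine (ih (by omega) (by push_cast at hb; omega)).trans ?_
    have := h (a + d + 1) (by omega)
    push_cast at this ⊢
    rwa [← add_assoc (a : ℤ)]

theorem mem_minCosetReps_leftIndices {j : ℕ} (hj : j ≤ n) {w : W} :
    w ∈ cs.minCosetReps (leftIndices n j) ↔ cs.IncreasingUpTo w j := by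
  constructor
  · intro h i hi
    rw [← cs.length_lt_length_mul_reflB_iff (by omega), cs.reflB_of_lt (by omega)]
    refine h _ ?_
    simp only [leftIndices, Set.mem_ofPred_eq, Fin.rev_rev]
    omega
  · intro h i hi
    simp only [leftIndices, Set.mem_ofPred_eq] at hi
    rw [← cs.reflB_rev, cs.length_lt_length_mul_reflB_iff i.rev.2]
    exact h _ (by omega)

theorem eq_one_of_increasingUpTo {w : W} (h : cs.IncreasingUpTo w n) : w = 1 := by
  by_contra hw
  obtain ⟨i, hi⟩ := cs.exists_rightDescent_of_ne_one hw
  have := (cs.mem_minCosetReps_leftIndices le_rfl).mpr h i (by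
    simp only [leftIndices, Set.mem_ofPred_eq]; omega)
  exact this.not_gt hi

theorem cosetPoint_cases (t : ℕ) : t < n ∧ cosetPoint n t = n - t ∨
    n ≤ t ∧ cosetPoint n t = n - 1 - t := by
  unfold cosetPoint; split_ifs <;> omega

/-- On the one-line notation of w, right multiplication by this inverse takes away the last entry
and reinserts it at position `|cosetPoint n t|`, negated if t ≥ n. -/
theorem signedPerm_cosetRepB_inv {t : ℕ} (ht : t < 2 * n) {q : ℤ} (hq : 1 ≤ q) (hqn : q ≤ n) :
    (q < |cosetPoint n t| → cs.signedPerm (cs.cosetRepB n t)⁻¹ q = q) ∧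
    (|cosetPoint n t| < q → cs.signedPerm (cs.cosetRepB n t)⁻¹ q = q - 1) ∧
    (q = |cosetPoint n t| →
      cs.signedPerm (cs.cosetRepB n t)⁻¹ q = if t < n then (n : ℤ) else -n) := by
  obtain ⟨h1, h2⟩ := cs.signedPerm_cosetRepB le_rfl (by omega) ht
  have hc := cosetPoint_cases (n := n) t
  simp only [map_inv, Equiv.Perm.inv_eq_iff_eq]
  refine ⟨fun h ↦ ?_, fun h ↦ ?_, fun h ↦ ?_⟩
  · rw [h2 q hq (by rw [lt_abs] at h; omega), if_pos h]
  · have hp : 1 ≤ |cosetPoint n t| := by rw [le_abs]; omega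
    rw [h2 (q - 1) (by omega) (by omega), if_neg (by omega)]
    omega
  · split_ifs with htn
    · rw [h1, h, abs_of_nonneg (by omega)]
    · rw [signedPerm_neg, h1, h, abs_of_neg (by omega)]

theorem increasingUpTo_cosetRepB {t : ℕ} (ht : t < 2 * n) :
    cs.IncreasingUpTo (cs.cosetRepB n t) (n - 1) := by
  intro i hi
  obtain ⟨-, h2⟩ := cs.signedPerm_cosetRepB le_rfl (by omega) ht
  rw [h2 (i + 1) (by omega) (by omega)]
  rcases Nat.eq_zero_or_pos i with rfl | h0
  · simp only [Nat.cast_zero, signedPerm_zero]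
    split_ifs <;> omega
  · rw [h2 i (by omega) (by omega)]
    split_ifs <;> omega

/-- Choose t so that the representative sends n to w(n). Its inverse closes the gap at |w(n)| among
the other values, so the quotient is increasing up to n and hence trivial. -/
theorem exists_eq_cosetRepB (hn : 2 ≤ n) {w : W} (hw : cs.IncreasingUpTo w (n - 1)) :
    ∃ t < 2 * n, w = cs.cosetRepB n t := by
  set p := cs.signedPerm w n with hp
  have hpn : |p| ≤ n := cs.abs_signedPerm_le w (by simp)
  have hp0 : p ≠ 0 := fun h ↦ by
    have := (cs.signedPerm w).injective (h.trans (cs.signedPerm_zero w).symm)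
    omega
  rw [abs_le] at hpn
  obtain ⟨t, ht, htp⟩ : ∃ t < 2 * n, cosetPoint n t = p := by
    rcases lt_or_gt_of_ne hp0 with h | h
    · refine ⟨(n - 1 - p).toNat, by omega, ?_⟩
      have := cosetPoint_cases (n := n) (n - 1 - p).toNat
      omega
    · refine ⟨(n - p).toNat, by omega, ?_⟩
      have := cosetPoint_cases (n := n) (n - p).toNat
      omega
  refine ⟨t, ht, ?_⟩
  have hu : ∀ i : ℤ, 1 ≤ i → i < n → 1 ≤ cs.signedPerm w i ∧
      (cs.signedPerm w i < |p| ∧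
        cs.signedPerm ((cs.cosetRepB n t)⁻¹ * w) i = cs.signedPerm w i ∨
      |p| < cs.signedPerm w i ∧
        cs.signedPerm ((cs.cosetRepB n t)⁻¹ * w) i = cs.signedPerm w i - 1) := by
    intro i hi hin
    have h1 := hw.lt le_rfl (show 0 < i by omega) (by omega)
    rw [signedPerm_zero] at h1
    have h2 : |cs.signedPerm w i| ≤ n := cs.abs_signedPerm_le w (by rw [abs_le]; omega)
    rw [abs_le] at h2
    have h3 : cs.signedPerm w i ≠ |p| := by
      intro h
      rcases abs_choice p with h' | h' <;> rw [h'] at h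
      · have := (cs.signedPerm w).injective h
        omega
      · rw [hp, ← signedPerm_neg] at h
        have := (cs.signedPerm w).injective h
        omega
    obtain ⟨e1, e2, -⟩ := cs.signedPerm_cosetRepB_inv ht (q := cs.signedPerm w i) (by omega) h2.2
    rw [htp] at e1 e2
    rw [map_mul, Equiv.Perm.mul_apply]
    rcases lt_or_gt_of_ne h3 with h | h
    · exact ⟨by omega, Or.inl ⟨h, e1 h⟩⟩
    · exact ⟨by omega, Or.inr ⟨h, e2 h⟩⟩
  have hun : cs.signedPerm ((cs.cosetRepB n t)⁻¹ * w) n = n := by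
    rw [map_mul, Equiv.Perm.mul_apply, map_inv, Equiv.Perm.inv_eq_iff_eq,
      (cs.signedPerm_cosetRepB le_rfl (by omega) ht).1, htp]
  have hp1 : 1 ≤ |p| := by rw [le_abs]; omega
  suffices (cs.cosetRepB n t)⁻¹ * w = 1 from (inv_mul_eq_one.mp this).symm
  refine cs.eq_one_of_increasingUpTo fun i hi ↦ ?_
  rcases Nat.eq_zero_or_pos i with rfl | h0
  · have := hu 1 le_rfl (by omega)
    simp only [Nat.cast_zero, signedPerm_zero, zero_add]
    omega
  · have h1 := hu i (by omega) (by omega)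
    rcases Nat.lt_or_ge (i + 1) n with h | h
    · have h2 := hu (i + 1) (by omega) (by omega)
      have h3 := hw i (by omega)
      omega
    -- The last ascent holds because n is fixed and is the largest possible value.
    · have hin : (i : ℤ) + 1 = n := by omega
      rw [hin, hun]
      have h2 : |cs.signedPerm ((cs.cosetRepB n t)⁻¹ * w) i| ≤ n :=
        cs.abs_signedPerm_le _ (by rw [Nat.abs_cast]; omega)
      rw [abs_le] at h2
      refine lt_of_le_of_ne h2.2 fun h ↦ ?_
      have := (cs.signedPerm _).injective (h.trans hun.symm)
      omega

theorem increasingUpTo_mul_cosetRepB_inv_iff {t j : ℕ} (ht : t < 2 * n)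
    (hj : (j : ℤ) < |cosetPoint n t|) (w : W) :
    cs.IncreasingUpTo (w * (cs.cosetRepB n t)⁻¹) j ↔ cs.IncreasingUpTo w j := by
  have hc := cosetPoint_cases (n := n) t
  refine forall₂_congr fun i hi ↦ ?_
  rw [lt_abs] at hj
  simp only [map_mul, Equiv.Perm.mul_apply]
  rw [(cs.signedPerm_cosetRepB_inv ht (q := i + 1) (by omega) (by omega)).1
    (by rw [lt_abs]; omega)]
  rcases Nat.eq_zero_or_pos i with rfl | h0
  · simp only [Nat.cast_zero, signedPerm_zero]
  · rw [(cs.signedPerm_cosetRepB_inv ht (q := i) (by omega) (by omega)).1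
      (by rw [lt_abs]; omega)]

/-- The first j entries are w(1), …, w(j-1) with ±w(n) inserted, so only the two neighbours of the
new entry matter; at position j there is no right neighbour to compare. -/
theorem increasingUpTo_mul_cosetRepB_inv_iff_of_le {t j : ℕ} (ht : t < 2 * n) (hjn : j ≤ n)
    (hj : |cosetPoint n t| ≤ j) (w : W) :
    cs.IncreasingUpTo (w * (cs.cosetRepB n t)⁻¹) j ↔
      cs.IncreasingUpTo w (j - 1) ∧
      cs.signedPerm w (|cosetPoint n t| - 1) < cs.signedPerm w (if t < n then (n : ℤ) else -n) ∧
      (|cosetPoint n t| < j →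
        cs.signedPerm w (if t < n then (n : ℤ) else -n) < cs.signedPerm w |cosetPoint n t|) := by
  have hc := cosetPoint_cases (n := n) t
  have hm : 1 ≤ |cosetPoint n t| := by rw [le_abs]; omega
  have hinv := fun q ↦ cs.signedPerm_cosetRepB_inv ht (q := q)
  set m := |cosetPoint n t|
  set c : ℤ := if t < n then (n : ℤ) else -n
  set g := cs.signedPerm (w * (cs.cosetRepB n t)⁻¹) with hg
  have g0 : g 0 = cs.signedPerm w 0 := by
    rw [hg, map_mul, Equiv.Perm.mul_apply, signedPerm_zero, signedPerm_zero]
  have g1 : ∀ q : ℤ, 0 ≤ q → q < m → g q = cs.signedPerm w q := by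
    intro q hq hqm
    rcases hq.eq_or_lt with rfl | hq
    · exact g0
    · rw [hg, map_mul, Equiv.Perm.mul_apply, (hinv q (by omega) (by omega)).1 hqm]
  have g2 : ∀ q : ℤ, m < q → q ≤ j → g q = cs.signedPerm w (q - 1) := by
    intro q hq hqj
    rw [hg, map_mul, Equiv.Perm.mul_apply, (hinv q (by omega) (by omega)).2.1 hq]
  have g3 : g m = cs.signedPerm w c := by
    rw [hg, map_mul, Equiv.Perm.mul_apply, (hinv m (by omega) (by omega)).2.2 rfl]
  constructor
  · intro h
    refine ⟨fun i hi ↦ ?_, ?_, fun hmj ↦ ?_⟩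
    · have e1 : g i = cs.signedPerm w i ∧ (i : ℤ) < m ∨
          g (i + 1) = cs.signedPerm w i ∧ m ≤ (i : ℤ) := by
        rcases lt_or_ge (i : ℤ) m with him | him
        · exact Or.inl ⟨g1 _ (by omega) him, him⟩
        · refine Or.inr ⟨?_, him⟩
          rw [g2 _ (by omega) (by omega), add_sub_cancel_right]
      have e2 : g (i + 1) = cs.signedPerm w (i + 1) ∧ (i : ℤ) + 1 < m ∨
          g (i + 1 + 1) = cs.signedPerm w (i + 1) ∧ m ≤ (i : ℤ) + 1 := by
        rcases lt_or_ge ((i : ℤ) + 1) m with him | him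
        · exact Or.inl ⟨g1 _ (by omega) him, him⟩
        · refine Or.inr ⟨?_, him⟩
          rw [g2 _ (by omega) (by omega), add_sub_cancel_right]
      rcases e1 with ⟨e1, h1⟩ | ⟨e1, h1⟩ <;> rcases e2 with ⟨e2, h2⟩ | ⟨e2, h2⟩ <;>
        rw [← e1, ← e2] <;> exact h.lt (by omega) (by omega) (by omega)
    · rw [← g1 (m - 1) (by omega) (by omega), ← g3]
      exact h.lt (by omega) (by omega) hj
    · have := g2 (m + 1) (by omega) (by omega)
      rw [add_sub_cancel_right] at this
      rw [← g3, ← this]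
      exact h.lt (by omega) (by omega) (by omega)
  · rintro ⟨h, h1, h2⟩ i hi
    rcases lt_trichotomy (i : ℤ) m with him | him | him
    · rw [← hg, g1 i (by omega) him]
      rcases (show (i : ℤ) + 1 ≤ m from him).eq_or_lt with him' | him'
      · rwa [him', g3, eq_sub_of_add_eq him']
      · rw [g1 _ (by omega) him']
        exact h.lt (by omega) (by omega) (by omega)
    · rw [← hg, him, g3, g2 _ (by omega) (by omega), add_sub_cancel_right]
      exact h2 (by omega)
    · rw [← hg, g2 _ him (by omega), g2 _ (by omega) (by omega), add_sub_cancel_right]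
      exact h.lt (by omega) (by omega) (by omega)

/-- The inserted entry must be positive, which forces the sign and the value |w(n)|; its place in
the increasing sequence is then forced too. -/
theorem existsUnique_increasingUpTo_mul_cosetRepB_inv {j : ℕ} (hj0 : 1 ≤ j) (hjn : j ≤ n) {w : W}
    (hw : cs.IncreasingUpTo w (j - 1)) :
    ∃! t : ℕ, t ∈ Finset.Ico (n - j) (n + j) ∧
      cs.IncreasingUpTo (w * (cs.cosetRepB n t)⁻¹) j := by
  have hinj := (cs.signedPerm w).injective
  have hneg := cs.signedPerm_neg w
  have h0 := cs.signedPerm_zero w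
  have hlt := fun {a b : ℤ} ha hab hb ↦ hw.lt (a := a) (b := b) ha hab hb
  have key : ∀ t ∈ Finset.Ico (n - j) (n + j),
      (cs.IncreasingUpTo (w * (cs.cosetRepB n t)⁻¹) j ↔
      cs.signedPerm w (|cosetPoint n t| - 1) < cs.signedPerm w (if t < n then (n : ℤ) else -n) ∧
      (|cosetPoint n t| < j →
        cs.signedPerm w (if t < n then (n : ℤ) else -n) <
          cs.signedPerm w |cosetPoint n t|)) := by
    intro t ht
    rw [Finset.mem_Ico] at ht
    rw [cs.increasingUpTo_mul_cosetRepB_inv_iff_of_le (by omega) hjn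
      (by have := cosetPoint_cases (n := n) t; rw [abs_le]; omega)]
    simp [hw]
  set f := cs.signedPerm w
  have hn0 : f n ≠ 0 := fun h ↦ by
    have := hinj (h.trans h0.symm)
    omega
  have habs : ∀ t : ℕ, |cosetPoint n t| = if t < n then (n : ℤ) - t else t + 1 - n := by
    intro t
    rcases cosetPoint_cases (n := n) t with ⟨h, e⟩ | ⟨h, e⟩
    · rw [e, if_pos h, abs_of_nonneg (by omega)]
    · rw [e, if_neg (by omega), abs_of_neg (by omega)]
      ring
  -- The place m is the first whose entry exceeds |w(n)|, or j if none before j does. The comparison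
  -- on the left is strict because w is injective and odd.
  have hex : ∃ m : ℕ, 1 ≤ m ∧ m ≤ j ∧ f (m - 1) < |f n| ∧ (m < j → |f n| < f m) := by
    have hP : ∃ m : ℕ, 1 ≤ m ∧ (m = j ∨ |f n| < f m) := ⟨j, hj0, Or.inl rfl⟩
    classical
    obtain ⟨hm1, hm2⟩ := Nat.find_spec hP
    have hmin := fun k hk ↦ Nat.find_min hP (m := k) hk
    have hmj : Nat.find hP ≤ j := Nat.find_min' hP ⟨hj0, Or.inl rfl⟩
    set m := Nat.find hP
    refine ⟨m, hm1, hmj, ?_, fun h ↦ hm2.resolve_left (by omega)⟩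
    rcases hm1.eq_or_lt with h | h
    · rw [← h]
      simpa [h0] using hn0
    · have h1 := hmin (m - 1) (by omega)
      push Not at h1
      have h2 := (h1 (by omega)).2
      rw [Nat.cast_sub hm1, Nat.cast_one] at h2
      refine lt_of_le_of_ne h2 fun h3 ↦ ?_
      rcases abs_choice (f n) with h' | h' <;> rw [h'] at h3
      · have := hinj h3
        omega
      · rw [← hneg] at h3
        have := hinj h3
        omega
  obtain ⟨m, hm1, hmj, hm2, hm3⟩ := hex
  -- These are the t for which `cosetPoint n t` is m and -m.
  refine ⟨if 0 < f n then n - m else n - 1 + m, ⟨?_, ?_⟩, ?_⟩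
  · rw [Finset.mem_Ico]
    split_ifs <;> omega
  · have hmem : (if 0 < f n then n - m else n - 1 + m) ∈ Finset.Ico (n - j) (n + j) := by
      rw [Finset.mem_Ico]
      split_ifs <;> omega
    rw [key _ hmem]
    have e1 : |cosetPoint n (if 0 < f n then n - m else n - 1 + m)| = m := by
      rw [habs]
      split_ifs <;> omega
    have e2 : f (if (if 0 < f n then n - m else n - 1 + m) < n then (n : ℤ) else -n) = |f n| := by
      split_ifs with h1 h2 h2
      · rw [abs_of_pos h1]
      · omega
      · omega
      · rw [hneg, abs_of_nonpos (by omega)]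
    rw [e1, e2]
    exact ⟨hm2, fun h ↦ hm3 (by omega)⟩
  · rintro t ⟨ht, h⟩
    obtain ⟨h1, h2⟩ := (key t ht).mp h
    rw [Finset.mem_Ico] at ht
    have hmt : |cosetPoint n t| = if t < n then (n : ℤ) - t else t + 1 - n := habs t
    set p := |cosetPoint n t|
    have hp1 : 1 ≤ p := by split_ifs at hmt <;> omega
    have hpj : p ≤ j := by split_ifs at hmt <;> omega
    have hpos : 0 ≤ f (p - 1) := by
      rcases hp1.eq_or_lt with h | h
      · rw [← h]; simp [h0]
      · have := hlt le_rfl (show 0 < p - 1 by omega) (by omega)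
        omega
    have hsign : t < n ∧ 0 < f n ∨ n ≤ t ∧ f n < 0 := by
      split_ifs at h1 with h
      · omega
      · rw [hneg] at h1; omega
    have hval : f (if t < n then (n : ℤ) else -n) = |f n| := by
      split_ifs with h
      · rw [abs_of_pos (by omega)]
      · rw [hneg, abs_of_neg (by omega)]
    rw [hval] at h1 h2
    have hmono : ∀ a b : ℤ, 0 ≤ a → a ≤ b → b ≤ (j - 1 : ℕ) → f a ≤ f b := by
      intro a b ha hab hb
      rcases hab.eq_or_lt with rfl | hab
      · exact le_rfl
      · exact (hlt ha hab hb).le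
    have hpm : p = m := by
      rcases lt_trichotomy p m with h | h | h
      · have h3 := h2 (by omega)
        have h4 := hmono p (m - 1) (by omega) (by omega) (by omega)
        omega
      · exact h
      · have h3 := hm3 (by omega)
        have h4 := hmono m (p - 1) (by omega) (by omega) (by omega)
        omega
    rcases hsign with ⟨h3, h4⟩ | ⟨h3, h4⟩
    · rw [if_pos h4]
      rw [if_pos h3] at hmt
      omega
    · rw [if_neg (by omega)]
      rw [if_neg (by omega)] at hmt
      omega

theorem cosetRepB_injOn : Set.InjOn (cs.cosetRepB n) {t | t < 2 * n} := by
  intro s hs t ht h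
  simp only [Set.mem_ofPred_eq] at hs ht
  have h1 := (cs.signedPerm_cosetRepB le_rfl (by omega) hs).1
  rw [h, (cs.signedPerm_cosetRepB le_rfl (by omega) ht).1] at h1
  have := cosetPoint_cases (n := n) t
  have := cosetPoint_cases (n := n) s
  omega

/-! ### The multiplication rule -/

section Product

variable [Fintype W]

open Classical in
theorem xB_eq_sum {j : ℕ} (hj : j ≤ n) :
    cs.xB j = ∑ w : W, if cs.IncreasingUpTo w j then MonoidAlgebra.of ℚ W w else 0 := by
  rw [xB, descentElt, Finset.sum_filter]
  exact Finset.sum_congr rfl fun w _ ↦ by simp only [cs.mem_minCosetReps_leftIndices hj]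

theorem xB_self : cs.xB n = 1 := by
  classical
  rw [cs.xB_eq_sum le_rfl, Finset.sum_eq_single 1]
  · rw [if_pos, map_one]
    intro i _
    simp
  · intro w _ hw
    rw [if_neg fun h ↦ hw (cs.eq_one_of_increasingUpTo h)]
  · simp

theorem xB_sub_one (hn : 2 ≤ n) :
    cs.xB (n - 1) = ∑ t ∈ Finset.range (2 * n), MonoidAlgebra.of ℚ W (cs.cosetRepB n t) := by
  classical
  rw [cs.xB_eq_sum (by omega), ← Finset.sum_filter]
  symm
  refine Finset.sum_nbij (cs.cosetRepB n) ?_ ?_ ?_ fun _ _ ↦ rfl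
  · intro t ht
    simpa using cs.increasingUpTo_cosetRepB (Finset.mem_range.mp ht)
  · intro s hs t ht
    exact cs.cosetRepB_injOn (by simpa using hs) (by simpa using ht)
  · intro w hw
    obtain ⟨t, ht, rfl⟩ := cs.exists_eq_cosetRepB hn (by simpa using hw)
    exact ⟨t, by simpa using ht, rfl⟩

open Classical in
theorem xB_mul_of {j : ℕ} (hj : j ≤ n) (v : W) :
    cs.xB j * MonoidAlgebra.of ℚ W v =
      ∑ w : W, if cs.IncreasingUpTo (w * v⁻¹) j then MonoidAlgebra.of ℚ W w else 0 := by
  rw [cs.xB_eq_sum hj, Finset.sum_mul]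
  refine Fintype.sum_equiv (Equiv.mulRight v) _ _ fun w ↦ ?_
  simp only [Equiv.coe_mulRight, mul_inv_cancel_right, map_mul]
  split_ifs <;> simp

theorem xB_mul_of_cosetRepB {j t : ℕ} (hj : j ≤ n) (ht : t < 2 * n)
    (h : t < n - j ∨ n + j ≤ t) :
    cs.xB j * MonoidAlgebra.of ℚ W (cs.cosetRepB n t) = cs.xB j := by
  classical
  rw [cs.xB_mul_of hj, cs.xB_eq_sum hj]
  refine Finset.sum_congr rfl fun w _ ↦ ?_
  rw [cs.increasingUpTo_mul_cosetRepB_inv_iff ht]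
  have := cosetPoint_cases (n := n) t
  rw [lt_abs]
  omega

theorem sum_xB_mul_of_cosetRepB {j : ℕ} (hj0 : 1 ≤ j) (hj : j ≤ n) :
    ∑ t ∈ Finset.Ico (n - j) (n + j), cs.xB j * MonoidAlgebra.of ℚ W (cs.cosetRepB n t) =
      cs.xB (j - 1) := by
  classical
  simp only [cs.xB_mul_of hj]
  rw [Finset.sum_comm, cs.xB_eq_sum (by omega)]
  refine Finset.sum_congr rfl fun w _ ↦ ?_
  by_cases hw : cs.IncreasingUpTo w (j - 1)
  · obtain ⟨t, ⟨ht, htw⟩, huniq⟩ :=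
      cs.existsUnique_increasingUpTo_mul_cosetRepB_inv hj0 hj hw
    rw [Finset.sum_eq_single_of_mem t ht fun s hs hst ↦
      if_neg fun h ↦ hst (huniq s ⟨hs, h⟩), if_pos htw, if_pos hw]
  · rw [if_neg hw]
    refine Finset.sum_eq_zero fun t ht ↦ if_neg fun h ↦ hw ?_
    rw [Finset.mem_Ico] at ht
    refine ((cs.increasingUpTo_mul_cosetRepB_inv_iff_of_le (by omega) hj ?_ w).mp h).1
    have := cosetPoint_cases (n := n) t
    rw [abs_le]
    omega

/-- The n-j smallest and the n-j largest t insert beyond position j and act trivially on x_j. -/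
theorem xB_mul_eq_add_sum (hn : 2 ≤ n) {j : ℕ} (hj : j ≤ n) :
    cs.xB j * cs.xB (n - 1) = (2 * ((n : ℚ) - j)) • cs.xB j +
      ∑ t ∈ Finset.Ico (n - j) (n + j), cs.xB j * MonoidAlgebra.of ℚ W (cs.cosetRepB n t) := by
  rw [cs.xB_sub_one hn, Finset.mul_sum, Finset.range_eq_Ico,
    ← Finset.sum_Ico_consecutive _ (Nat.zero_le (n - j)) (show n - j ≤ 2 * n by omega),
    ← Finset.sum_Ico_consecutive _ (show n - j ≤ n + j by omega) (show n + j ≤ 2 * n by omega)]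
  have h1 : ∑ t ∈ Finset.Ico 0 (n - j), cs.xB j * MonoidAlgebra.of ℚ W (cs.cosetRepB n t) =
      ((n : ℚ) - j) • cs.xB j := by
    rw [Finset.sum_congr rfl fun t ht ↦ cs.xB_mul_of_cosetRepB hj
      (by rw [Finset.mem_Ico] at ht; omega) (by rw [Finset.mem_Ico] at ht; omega)]
    rw [Finset.sum_const, Nat.card_Ico, Nat.sub_zero, ← Nat.cast_smul_eq_nsmul ℚ,
      Nat.cast_sub hj]
  have h2 : ∑ t ∈ Finset.Ico (n + j) (2 * n), cs.xB j * MonoidAlgebra.of ℚ W (cs.cosetRepB n t) =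
      ((n : ℚ) - j) • cs.xB j := by
    rw [Finset.sum_congr rfl fun t ht ↦ cs.xB_mul_of_cosetRepB hj
      (by rw [Finset.mem_Ico] at ht; omega) (by rw [Finset.mem_Ico] at ht; omega)]
    rw [Finset.sum_const, Nat.card_Ico, show 2 * n - (n + j) = n - j by omega,
      ← Nat.cast_smul_eq_nsmul ℚ, Nat.cast_sub hj]
  rw [h1, h2, two_mul, add_smul]
  abel

theorem xB_mul (hn : 2 ≤ n) {j : ℕ} (hj0 : 1 ≤ j) (hj : j ≤ n) :
    cs.xB j * cs.xB (n - 1) = (2 * ((n : ℚ) - j)) • cs.xB j + cs.xB (j - 1) := by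
  rw [cs.xB_mul_eq_add_sum hn hj, cs.sum_xB_mul_of_cosetRepB hj0 hj]

theorem xB_zero_mul (hn : 2 ≤ n) :
    cs.xB 0 * cs.xB (n - 1) = (2 * (n : ℚ)) • cs.xB 0 := by
  rw [cs.xB_mul_eq_add_sum hn (Nat.zero_le n)]
  simp

end Product

end CoxeterSystem

/-! ### Falling products and Stirling numbers -/

/-- The polynomial `X (X - 2) ⋯ (X - 2 (k - 1))`. -/
noncomputable def evenFalling (k : ℕ) : ℚ[X] := ∏ i ∈ Finset.range k, (X - C (2 * (i : ℚ)))

theorem evenFalling_zero : evenFalling 0 = 1 := by simp [evenFalling]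

theorem evenFalling_succ (k : ℕ) :
    evenFalling (k + 1) = evenFalling k * (X - C (2 * (k : ℚ))) := Finset.prod_range_succ _ _

theorem evenFalling_eq_sum_stirlingFirst (k : ℕ) :
    evenFalling k = ∑ m ∈ Finset.range (k + 1),
      ((-2 : ℚ) ^ (k - m) * (Nat.stirlingFirst k m : ℚ)) • X ^ m := by
  induction k with
  | zero => simp [evenFalling_zero]
  | succ k ih =>
    -- The index shift in `h1` drops this constant term; for k = 0 it is the factor k that vanishes.
    have h0 : (k : ℚ) * Nat.stirlingFirst k 0 = 0 := by cases k <;> simp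
    have h1 : ∑ m ∈ Finset.range (k + 1),
        ((-2 : ℚ) ^ (k - m) * (k * Nat.stirlingFirst k (m + 1))) • (X : ℚ[X]) ^ (m + 1) =
        (-2 * (k : ℚ)) • evenFalling k := by
      rw [Finset.sum_range_succ, ih, Finset.sum_range_succ',
        Nat.stirlingFirst_eq_zero_of_lt (Nat.lt_succ_self k), smul_add, Finset.smul_sum]
      simp only [smul_smul]
      rw [show -2 * (k : ℚ) * ((-2) ^ (k - 0) * Nat.stirlingFirst k 0) =
        -2 * (-2) ^ (k - 0) * (k * Nat.stirlingFirst k 0) by ring, h0]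
      simp only [Nat.cast_zero, mul_zero, zero_smul, add_zero]
      refine Finset.sum_congr rfl fun m hm ↦ ?_
      rw [Finset.mem_range] at hm
      rw [show k - m = k - (m + 1) + 1 by omega, pow_succ]
      congr 1
      ring
    have h2 : ∑ m ∈ Finset.range (k + 1),
        ((-2 : ℚ) ^ (k - m) * Nat.stirlingFirst k m) • (X : ℚ[X]) ^ (m + 1) =
        evenFalling k * X := by
      rw [ih, Finset.sum_mul]
      exact Finset.sum_congr rfl fun m _ ↦ by rw [pow_succ, smul_mul_assoc]
    rw [Finset.sum_range_succ', Nat.stirlingFirst_succ_zero]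
    simp only [Nat.cast_zero, mul_zero, zero_smul, add_zero, Nat.stirlingFirst_succ_succ,
      Nat.cast_add, Nat.cast_mul, mul_add, add_smul, Nat.add_sub_add_right]
    rw [Finset.sum_add_distrib, h1, h2, evenFalling_succ, mul_sub, smul_eq_C_mul]
    simp only [map_mul, map_neg]
    ring

theorem X_pow_eq_sum_stirlingSecond (k : ℕ) :
    (X : ℚ[X]) ^ k = ∑ m ∈ Finset.range (k + 1),
      ((Nat.stirlingSecond k m : ℚ) * (2 : ℚ) ^ (k - m)) • evenFalling m := by
  induction k with
  | zero => simp [evenFalling_zero]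
  | succ k ih =>
    have h1 : ∑ m ∈ Finset.range (k + 1),
        (((m + 1) * Nat.stirlingSecond k (m + 1) : ℚ) * (2 : ℚ) ^ (k - m)) • evenFalling (m + 1) =
        ∑ m ∈ Finset.range (k + 1),
        ((Nat.stirlingSecond k m : ℚ) * (2 : ℚ) ^ (k - m) * (2 * m)) • evenFalling m := by
      rw [Finset.sum_range_succ, Finset.sum_range_succ' _ k,
        Nat.stirlingSecond_eq_zero_of_lt (Nat.lt_succ_self k)]
      simp only [Nat.cast_zero, mul_zero, zero_mul, zero_smul, add_zero]
      refine Finset.sum_congr rfl fun m hm ↦ ?_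
      rw [Finset.mem_range] at hm
      rw [show k - m = k - (m + 1) + 1 by omega, pow_succ]
      congr 1
      push_cast
      ring
    rw [Finset.sum_range_succ', Nat.stirlingSecond_succ_zero]
    simp only [Nat.cast_zero, zero_mul, zero_smul, add_zero, Nat.stirlingSecond_succ_succ,
      Nat.cast_add, Nat.cast_mul, Nat.cast_one, add_mul _ _ ((2 : ℚ) ^ _), add_smul,
      Nat.add_sub_add_right]
    rw [Finset.sum_add_distrib, h1, ← Finset.sum_add_distrib, pow_succ, ih, Finset.sum_mul]
    refine Finset.sum_congr rfl fun m _ ↦ ?_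
    rw [evenFalling_succ]
    simp only [smul_eq_C_mul, map_mul]
    ring

/-- Up to a nonzero constant, halving the variable turns the falling power into the polynomial that
annihilates x_{n-1}. -/
theorem descPochhammer_comp_half (k : ℕ) :
    (descPochhammer ℚ k).comp (C (1 / 2) * X) = C ((1 / 2) ^ k) * evenFalling k := by
  induction k with
  | zero => simp [evenFalling_zero]
  | succ k ih =>
    have h : (C (1 / 2) * X - (k : ℚ[X])) = C (1 / 2) * (X - C (2 * (k : ℚ))) := by
      rw [mul_sub, ← C_mul, show (1 / 2 : ℚ) * (2 * k) = k by ring, map_natCast]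
    rw [descPochhammer_succ_right, mul_comp, ih, evenFalling_succ, sub_comp, X_comp, natCast_comp,
      h, pow_succ]
    simp only [map_mul]
    ring

/-! ### Bases of 𝔈(W) -/

namespace CoxeterSystem

variable {n : ℕ} {W : Type*} [Group W] (cs : CoxeterSystem (CoxeterMatrix.B n) W)

/-- The only descent of s_j is at j. The default value `reflB n = 1` supplies the case j = n, so
there are n+1 test elements for the n+1 elements x_i. -/
theorem increasingUpTo_reflB_iff {i j : ℕ} (hi : i ≤ n) (hj : j ≤ n) :
    cs.IncreasingUpTo (cs.reflB j) i ↔ i ≤ j := by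
  rcases hj.eq_or_lt with rfl | hj
  · simp only [hi, iff_true]
    intro k _
    simp [reflB]
  constructor
  · intro h
    by_contra hij
    have := h j (by omega)
    rw [cs.signedPerm_reflB hj, cs.signedPerm_reflB hj] at this
    rcases Nat.eq_zero_or_pos j with rfl | h0
    · have h1 := signedSwap_zero_cases 0
      have h2 := signedSwap_zero_cases 1
      simp only [Nat.cast_zero, zero_add] at this
      omega
    · have h1 := signedSwap_cases h0 j
      have h2 := signedSwap_cases h0 (j + 1)
      omega
  · intro h k hk
    rw [cs.signedPerm_reflB hj, cs.signedPerm_reflB hj]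
    have h1 := signedSwap_cases (i := j) (by omega) k
    have h2 := signedSwap_cases (i := j) (by omega) (k + 1)
    omega

variable [Fintype W]

theorem coeff_xB_reflB {i j : ℕ} (hi : i ≤ n) (hj : j ≤ n) :
    (cs.xB i).coeff (cs.reflB j) = if i ≤ j then 1 else 0 := by
  classical
  simp only [← cs.increasingUpTo_reflB_iff hi hj]
  rw [cs.xB_eq_sum hi, MonoidAlgebra.coeff_sum,
    Finset.sum_apply', Finset.sum_eq_single (cs.reflB j)]
  · split_ifs <;> simp
  · intro w _ hw
    split_ifs <;> simp [hw]
  · simp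

theorem linearIndependent_xB :
    LinearIndependent ℚ fun j : Fin (n + 1) ↦ cs.xB j := by
  rw [Fintype.linearIndependent_iff]
  intro g hg i
  induction i using WellFoundedLT.induction with
  | ind j ih =>
    have h := congrArg (fun x : MonoidAlgebra ℚ W ↦ x.coeff (cs.reflB j)) hg
    simp only [MonoidAlgebra.coeff_sum, Finset.sum_apply', MonoidAlgebra.coeff_smul,
      Finsupp.smul_apply, MonoidAlgebra.coeff_zero, Finsupp.zero_apply] at h
    rw [Finset.sum_eq_single j] at h
    · rwa [cs.coeff_xB_reflB (by omega) (by omega), if_pos le_rfl, smul_eq_mul, mul_one] at h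
    · intro i _ hij
      rcases lt_or_gt_of_ne hij with h' | h'
      · rw [ih i h', zero_smul]
      · rw [cs.coeff_xB_reflB (by omega) (by omega), if_neg (by omega), smul_zero]
    · simp

theorem aeval_evenFalling (hn : 2 ≤ n) {k : ℕ} (hk : k ≤ n) :
    aeval (cs.xB (n - 1)) (evenFalling k) = cs.xB (n - k) := by
  induction k with
  | zero => simp [evenFalling_zero, xB_self]
  | succ k ih =>
    rw [evenFalling_succ, map_mul, ih (by omega), map_sub, aeval_X, aeval_C, mul_sub,
      cs.xB_mul hn (by omega) (by omega), ← Algebra.commutes, ← Algebra.smul_def,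
      Nat.cast_sub (by omega), sub_sub_cancel, add_sub_cancel_left, Nat.sub_sub]

theorem aeval_evenFalling_succ_self (hn : 2 ≤ n) :
    aeval (cs.xB (n - 1)) (evenFalling (n + 1)) = 0 := by
  rw [evenFalling_succ, map_mul, cs.aeval_evenFalling hn le_rfl, Nat.sub_self, map_sub, aeval_X,
    aeval_C, mul_sub, cs.xB_zero_mul hn, ← Algebra.commutes, ← Algebra.smul_def, sub_self]

theorem coe_aeval_genEB (p : ℚ[X]) :
    (aeval cs.genEB p : MonoidAlgebra ℚ W) = aeval (cs.xB (n - 1)) p :=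
  (aeval_algHom_apply cs.algEB.val cs.genEB p).symm

theorem exists_aeval_genEB_eq (y : cs.algEB) : ∃ p : ℚ[X], aeval cs.genEB p = y := by
  have hy : (y : MonoidAlgebra ℚ W) ∈ Algebra.adjoin ℚ {cs.xB (n - 1)} := y.2
  rw [Algebra.adjoin_singleton_eq_range_aeval] at hy
  obtain ⟨p, hp⟩ := hy
  exact ⟨p, Subtype.ext ((cs.coe_aeval_genEB p).trans hp)⟩

theorem coe_aeval_genEB_evenFalling (hn : 2 ≤ n) (j : Fin (n + 1)) :
    (aeval cs.genEB (evenFalling (n - j)) : MonoidAlgebra ℚ W) = cs.xB j := by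
  rw [coe_aeval_genEB, cs.aeval_evenFalling hn (by omega), Nat.sub_sub_self (by omega)]

/-- The span contains 1 and, by the recursion of `evenFalling`, is closed under multiplication by
the generator; at j = 0 the next term is zero. So it contains all powers of the generator. -/
theorem span_xB_eq_top (hn : 2 ≤ n) :
    ⊤ ≤ Submodule.span ℚ
      (Set.range fun j : Fin (n + 1) ↦ aeval cs.genEB (evenFalling (n - j))) := by
  set S := Submodule.span ℚ
    (Set.range fun j : Fin (n + 1) ↦ aeval cs.genEB (evenFalling (n - j))) with hS
  have hmem : ∀ k ≤ n, aeval cs.genEB (evenFalling k) ∈ S := fun k hk ↦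
    Submodule.subset_span ⟨⟨n - k, by omega⟩, by simp only [Nat.sub_sub_self hk]⟩
  have hz : aeval cs.genEB (evenFalling (n + 1)) = 0 :=
    Subtype.ext ((cs.coe_aeval_genEB _).trans (cs.aeval_evenFalling_succ_self hn))
  have hmul : ∀ y ∈ S, y * cs.genEB ∈ S := by
    intro y hy
    induction hy using Submodule.span_induction with
    | mem x hx =>
      obtain ⟨j, rfl⟩ := hx
      have h : aeval cs.genEB (evenFalling (n - j)) * cs.genEB =
          aeval cs.genEB (evenFalling (n - j + 1)) +
            (2 * ((n - j : ℕ) : ℚ)) • aeval cs.genEB (evenFalling (n - j)) := by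
        rw [evenFalling_succ, map_mul, map_sub, aeval_X, aeval_C, mul_sub, ← Algebra.commutes,
          ← Algebra.smul_def, sub_add_cancel]
      simp only [h]
      refine add_mem ?_ (S.smul_mem _ (hmem _ (by omega)))
      rcases Nat.eq_zero_or_pos j with h0 | h0
      · rw [h0, Nat.sub_zero, hz]
        exact zero_mem _
      · exact hmem _ (by omega)
    | zero => simp
    | add x y _ _ hx hy => rw [add_mul]; exact add_mem hx hy
    | smul a x _ hx => rw [smul_mul_assoc]; exact S.smul_mem a hx
  have hpow : ∀ k, cs.genEB ^ k ∈ S := by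
    intro k
    induction k with
    | zero => simpa [evenFalling_zero] using hmem 0 (Nat.zero_le n)
    | succ k ih => rw [pow_succ]; exact hmul _ ih
  intro y _
  obtain ⟨p, rfl⟩ := cs.exists_aeval_genEB_eq y
  rw [aeval_eq_sum_range]
  exact sum_mem fun k _ ↦ S.smul_mem _ (hpow k)

theorem linearIndependent_aeval_genEB (hn : 2 ≤ n) :
    LinearIndependent ℚ fun j : Fin (n + 1) ↦ aeval cs.genEB (evenFalling (n - j)) := by
  refine LinearIndependent.of_comp cs.algEB.val.toLinearMap ?_
  have h : (cs.algEB.val.toLinearMap ∘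
      fun j : Fin (n + 1) ↦ aeval cs.genEB (evenFalling (n - j))) = fun j : Fin (n + 1) ↦ cs.xB j :=
    funext fun j ↦ cs.coe_aeval_genEB_evenFalling hn j
  rw [h]
  exact cs.linearIndependent_xB

/-- The basis of `𝔈(W)` that consists of the elements `x_0, …, x_n`. -/
noncomputable def basisXB (hn : 2 ≤ n) : Module.Basis (Fin (n + 1)) ℚ cs.algEB :=
  Module.Basis.mk (cs.linearIndependent_aeval_genEB hn) (cs.span_xB_eq_top hn)

theorem coe_basisXB (hn : 2 ≤ n) (j : Fin (n + 1)) :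
    (cs.basisXB hn j : MonoidAlgebra ℚ W) = cs.xB j := by
  rw [basisXB, Module.Basis.mk_apply, cs.coe_aeval_genEB_evenFalling hn]

theorem finrank_algEB (hn : 2 ≤ n) : Module.finrank ℚ cs.algEB = n + 1 := by
  rw [Module.finrank_eq_card_basis (cs.basisXB hn), Fintype.card_fin]

theorem span_genEB_pow_eq_top (hn : 2 ≤ n) :
    ⊤ ≤ Submodule.span ℚ (Set.range fun k : Fin (n + 1) ↦ cs.genEB ^ (k : ℕ)) := by
  refine (cs.span_xB_eq_top hn).trans (Submodule.span_le.mpr ?_)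
  rintro _ ⟨j, rfl⟩
  simp only [evenFalling_eq_sum_stirlingFirst, map_sum, map_smul, map_pow, aeval_X]
  refine sum_mem fun m hm ↦ Submodule.smul_mem _ _ (Submodule.subset_span ⟨⟨m, ?_⟩, rfl⟩)
  rw [Finset.mem_range] at hm
  omega

/-! ### The presentation of 𝔈(W) as a quotient -/

/-- The map from `ℚ[X] / (X (X - 1) ⋯ (X - n))` to `𝔈(W)` that sends `X` to half of the
generator. -/
noncomputable def quotientToAlgEB (hn : 2 ≤ n) :
    (ℚ[X] ⧸ Ideal.span {descPochhammer ℚ (n + 1)}) →ₐ[ℚ] cs.algEB :=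
  Ideal.Quotient.liftₐ _ ((aeval cs.genEB).comp (aeval (C (1 / 2 : ℚ) * X) : ℚ[X] →ₐ[ℚ] ℚ[X])) <| by
    intro a ha
    obtain ⟨b, rfl⟩ := Ideal.mem_span_singleton.mp ha
    have h : aeval (C (1 / 2 : ℚ) * X) (descPochhammer ℚ (n + 1)) =
        C ((1 / 2) ^ (n + 1)) * evenFalling (n + 1) := by
      rw [← descPochhammer_comp_half]; rfl
    have hz : aeval cs.genEB (evenFalling (n + 1)) = 0 :=
      Subtype.ext ((cs.coe_aeval_genEB _).trans (cs.aeval_evenFalling_succ_self hn))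
    rw [map_mul, AlgHom.comp_apply, h, map_mul, hz, mul_zero, zero_mul]

theorem quotientToAlgEB_mk (hn : 2 ≤ n) (p : ℚ[X]) :
    cs.quotientToAlgEB hn (Ideal.Quotient.mk _ p) =
      aeval cs.genEB (aeval (C (1 / 2 : ℚ) * X) p) := rfl

theorem quotientToAlgEB_gen (hn : 2 ≤ n) :
    cs.quotientToAlgEB hn (Ideal.Quotient.mk _ (2 * descPochhammer ℚ 1)) = cs.genEB := by
  rw [quotientToAlgEB_mk, descPochhammer_one]
  have : aeval (C (1 / 2 : ℚ) * X) (2 * X : ℚ[X]) = X := by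
    rw [map_mul, aeval_X, map_ofNat, ← mul_assoc, ← map_ofNat C 2, ← C_mul]
    norm_num
  rw [this, aeval_X]

theorem quotientToAlgEB_surjective (hn : 2 ≤ n) :
    Function.Surjective (cs.quotientToAlgEB hn) := by
  intro y
  obtain ⟨p, rfl⟩ := cs.exists_aeval_genEB_eq y
  refine ⟨aeval (Ideal.Quotient.mk _ (2 * descPochhammer ℚ 1)) p, ?_⟩
  rw [← aeval_algHom_apply, quotientToAlgEB_gen]

/-- A surjection between spaces of the same dimension n+1 is injective. -/
theorem quotientToAlgEB_bijective (hn : 2 ≤ n) :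
    Function.Bijective (cs.quotientToAlgEB hn) := by
  have h1 : Module.finrank ℚ (ℚ[X] ⧸ Ideal.span {descPochhammer ℚ (n + 1)}) = n + 1 := by
    rw [finrank_quotient_span_eq_natDegree, descPochhammer_natDegree]
  have : FiniteDimensional ℚ (ℚ[X] ⧸ Ideal.span {descPochhammer ℚ (n + 1)}) :=
    Module.finite_of_finrank_pos (by omega)
  have : FiniteDimensional ℚ cs.algEB := (cs.basisXB hn).finiteDimensional_of_finite
  refine ⟨?_, cs.quotientToAlgEB_surjective hn⟩
  exact (LinearMap.injective_iff_surjective_of_finrank_eq_finrank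
    (f := (cs.quotientToAlgEB hn).toLinearMap) (h1.trans (cs.finrank_algEB hn).symm)).mpr
      (cs.quotientToAlgEB_surjective hn)

end CoxeterSystem

theorem mainTheorem5 {n : ℕ} (hn : 2 ≤ n) {W : Type*} [Group W] [Fintype W]
    (cs : CoxeterSystem (CoxeterMatrix.B n) W) :
    (∃ φ : cs.algEB ≃ₐ[ℚ] (ℚ[X] ⧸ Ideal.span {descPochhammer ℚ (n + 1)}),
      φ cs.genEB = Ideal.Quotient.mk _ (2 * descPochhammer ℚ 1)) ∧
    (∃ b : Module.Basis (Fin (n + 1)) ℚ cs.algEB,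
      ∀ j : Fin (n + 1), (b j : MonoidAlgebra ℚ W) = cs.xB j) ∧
    (∃ c : Module.Basis (Fin (n + 1)) ℚ cs.algEB,
      ∀ k : Fin (n + 1), (c k : MonoidAlgebra ℚ W) = cs.xB (n - 1) ^ (k : ℕ)) ∧
    ∀ k : ℕ, k ≤ n →
      cs.xB (n - k) =
        aeval (cs.xB (n - 1)) (∏ i ∈ Finset.range k, (X - C (2 * (i : ℚ)))) ∧
      cs.xB (n - k) =
        ∑ m ∈ Finset.range (k + 1),
          ((-2 : ℚ) ^ (k - m) * (Nat.stirlingFirst k m : ℚ)) • cs.xB (n - 1) ^ m ∧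
      cs.xB (n - 1) ^ k =
        ∑ m ∈ Finset.range (k + 1),
          ((Nat.stirlingSecond k m : ℚ) * (2 : ℚ) ^ (k - m)) • cs.xB (n - m) := by
  refine ⟨⟨(AlgEquiv.ofBijective _ (cs.quotientToAlgEB_bijective hn)).symm, ?_⟩,
    ⟨cs.basisXB hn, cs.coe_basisXB hn⟩,
    ⟨basisOfTopLeSpanOfCardEqFinrank _ (cs.span_genEB_pow_eq_top hn)
      (by rw [cs.finrank_algEB hn, Fintype.card_fin]), fun k ↦ ?_⟩, fun k hk ↦ ?_⟩
  · rw [AlgEquiv.symm_apply_eq]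
    exact (cs.quotientToAlgEB_gen hn).symm
  · rw [coe_basisOfTopLeSpanOfCardEqFinrank]
    rfl
  · refine ⟨(cs.aeval_evenFalling hn hk).symm, ?_, ?_⟩
    · rw [← cs.aeval_evenFalling hn hk, evenFalling_eq_sum_stirlingFirst]
      simp
    · rw [← aeval_X (R := ℚ) (cs.xB (n - 1)), ← map_pow, X_pow_eq_sum_stirlingSecond, map_sum]
      refine Finset.sum_congr rfl fun m hm ↦ ?_
      rw [Finset.mem_range] at hm
      rw [map_smul, cs.aeval_evenFalling hn (by omega)]
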